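/- Let $N\ge 1$ and let $\mathfrak{su}(N)$ be the real Lie algebra of traceless skew-Hermitian complex $N\times N$ matrices. Let $B=(b_{ij})\in\mathfrak{su}(N)$, and let $A=-i\tilde H_0\in\mathfrak{su}(N)$ be diagonal, $\tilde H_0=\operatorname{diag}(\mathcal E_1,\dots,\mathcal E_N)$ with real entries ordered as $\mathcal E_1\le\dots\le\mathcal E_N$ (and $\sum_i\mathcal E_i=0$). Let $\Gamma^+=\{(i,j): 1\le i<j\le N,\ b_{ij}\ne 0\}$ be the set of positive roots touched by $B$, where the root attached to $(i,j)$ takes the value $\alpha_{ij}(\tilde H_0)=\mathcal E_j-\mathcal E_i$. Assume that (a) the graph $\mathcal G_B$ with nodes $1,\dots,N$ and arcs $\{(i,j): b_{ij}\neq 0\}$ is connected, and (b) $A$ is $B$-regular, i.e. the numbers $\mathcal E_j-\mathcal E_i$, $(i,j)\in\Gamma^+$, are nonzero and pairwise distinct. Then the system $$\dot X(t)=(A+u(t)B)\,X(t),\qquad X(t)\in SU(N),\qquad X(0)=I,$$ is controllable: for every $\bar X\in SU(N)$ there are a time $T\ge 0$ and a piecewise constant input $u:[0,T]\to\mathbb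 R$ such that the corresponding solution (continuous, and satisfying the equation away from the breakpoints of $u$) satisfies $X(T)=\bar X$. -/

import Mathlib

namespace QuantumControl

/-- The real vector space underlying the Lie algebra `su(N)` of traceless skew-Hermitian complex `N × N` matrices. -/
def su (N : ℕ) : Submodule ℝ (Matrix (Fin N) (Fin N) ℂ) where
  carrier := {M | M.conjTranspose = -M ∧ M.trace = 0}
  add_mem' := by
    rintro a b ⟨ha, ha'⟩ ⟨hb, hb'⟩
    refine ⟨?_, ?_⟩
    · rw [Matrix.conjTranspose_add, ha, hb, neg_add]
    · rw [Matrix.trace_add, ha', hb', add_zero]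
  zero_mem' := by simp
  smul_mem' := by
    rintro c a ⟨ha, ha'⟩
    refine ⟨?_, ?_⟩
    · rw [Matrix.conjTranspose_smul, ha, star_trivial, smul_neg]
    · rw [Matrix.trace_smul, ha', smul_zero]

/-- The `i`-th energy level of a diagonal drift `A = -i H₀`: the `i`-th diagonal entry of the
(real, diagonal) free Hamiltonian `H₀ = i A`. -/
def energy {N : ℕ} (A : Matrix (Fin N) (Fin N) ℂ) (i : Fin N) : ℝ :=
  (Complex.I * A i i).re

/-- The value at `H₀ = i A` of the root attached to the pair `p = (i, j)`, that is, the transition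
`ℰ_j - ℰ_i` between two energy levels. -/
def rootValue {N : ℕ} (A : Matrix (Fin N) (Fin N) ℂ) (p : Fin N × Fin N) : ℝ :=
  energy A p.2 - energy A p.1

/-- The positive roots touched by `B`: the pairs `i < j` with `b_{ij} ≠ 0`. -/
def touchedRoots {N : ℕ} (B : Matrix (Fin N) (Fin N) ℂ) : Set (Fin N × Fin N) :=
  {p | p.1 < p.2 ∧ B p.1 p.2 ≠ 0}

/-- `A` is `B`-regular: the values at `H₀` of the positive roots touched by `B` are nonzero and
pairwise distinct. -/
def IsRegularAlong {N : ℕ} (A B : Matrix (Fin N) (Fin N) ℂ) : Prop :=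
  (∀ p ∈ touchedRoots B, rootValue A p ≠ 0) ∧ Set.InjOn (rootValue A) (touchedRoots B)

/-- The directed graph of a square matrix: there is an arc from `i` to `j` iff `b_{ij} ≠ 0`. -/
def matrixGraph {N : ℕ} (B : Matrix (Fin N) (Fin N) ℂ) : Digraph (Fin N) where
  Adj i j := B i j ≠ 0

/-- `u` is piecewise constant with breakpoints in the finite set `D`: it is constant on every
interval that avoids `D`. -/
def IsPiecewiseConstant (u : ℝ → ℝ) (D : Finset ℝ) : Prop :=
  ∀ s t : ℝ, s ≤ t → (∀ d ∈ D, d ∉ Set.Icc s t) → u s = u t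

/-- `X` is the integral curve on `[0, T]` of `X' = (A + u B) X`, `X 0 = I`, in `SU(N)`, for an input
`u` with breakpoints in `D`: it is continuous and solves the equation off `D`
(the derivative is taken entrywise). -/
def IsIntegralCurve {N : ℕ} (A B : Matrix (Fin N) (Fin N) ℂ) (u : ℝ → ℝ) (D : Finset ℝ) (T : ℝ)
    (X : ℝ → Matrix.specialUnitaryGroup (Fin N) ℂ) : Prop :=
  X 0 = 1 ∧ ContinuousOn X (Set.Icc 0 T) ∧
    ∀ t ∈ Set.Ioo 0 T, t ∉ D → ∀ i j : Fin N,
      HasDerivAt (fun s => (X s : Matrix (Fin N) (Fin N) ℂ) i j)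
        (((A + u t • B) * (X t : Matrix (Fin N) (Fin N) ℂ)) i j) t

/-- The set of all points of `SU(N)` that are reached from the identity in some time `T ≥ 0` along
an integral curve of `X' = (A + u B) X` with a piecewise constant input `u`. -/
def reachableSet {N : ℕ} (A B : Matrix (Fin N) (Fin N) ℂ) :
    Set (Matrix.specialUnitaryGroup (Fin N) ℂ) :=
  {Y | ∃ T : ℝ, 0 ≤ T ∧ ∃ (u : ℝ → ℝ) (D : Finset ℝ)
      (X : ℝ → Matrix.specialUnitaryGroup (Fin N) ℂ),
    IsPiecewiseConstant u D ∧ IsIntegralCurve A B u D T X ∧ X T = Y}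

/-- The system `X' = (A + u B) X` on `SU(N)` is (globally) controllable. -/
def IsControllable {N : ℕ} (A B : Matrix (Fin N) (Fin N) ℂ) : Prop :=
  reachableSet A B = Set.univ

end QuantumControl

namespace QuantumControl

/-! Two facts combine: `A` and `B` generate `su(N)`, and compactness makes the irreversible drift
harmless.

Generation: `ad A` multiplies the entry `(i, j)` by `i` times its root value, so `(ad A)²` acts on
entries by real scalars. Regularity separates the touched positive roots, and a polynomial in `(ad
A)²` extracts each root component of `B` (`elemSkew_mem_of_touched`). Brackets along paths of the
connected graph give the remaining root vectors, whose brackets give the traceless diagonal part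
(`su_le_of_mem`).

Reachability: let `S` be the semigroup generated by `exp (t (A + cB))`, `t ≥ 0`. Its closure is a
group (`closure_flowMonoid`), so the conjugates of the `A + cB` under that group span a Lie algebra,
which contains `su(N)`. Products of flows are lengthened until their velocities fill it
(`IsVelocitySpace.exists_lt`), so `S` has an interior point. The closure is then an open subgroup,
hence all of `SU(N)`, and a dense semigroup with an interior point is everything
(`submonoid_eq_top_of_dense`). Concatenated constant inputs realise `S`. -/

open Matrix

variable {N : ℕ}

/-! ### Elementary skew-Hermitian matrices -/

/-- The elementary skew-Hermitian matrix `z E_ij - z̄ E_ji`. -/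
def elemSkew (i j : Fin N) (z : ℂ) : Matrix (Fin N) (Fin N) ℂ :=
  single i j z - single j i (star z)

theorem elemSkew_swap (i j : Fin N) (z : ℂ) : elemSkew j i z = -elemSkew i j (star z) := by
  simp [elemSkew]

theorem elemSkew_add (i j : Fin N) (z w : ℂ) :
    elemSkew i j (z + w) = elemSkew i j z + elemSkew i j w := by
  simp only [elemSkew, star_add, single_add]; abel

theorem elemSkew_smul (i j : Fin N) (r : ℝ) (z : ℂ) :
    elemSkew i j (r • z) = r • elemSkew i j z := by
  simp only [elemSkew, smul_sub, smul_single, star_smul, star_trivial]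

theorem elemSkew_bracket {i j k : Fin N} (hij : i ≠ j) (hjk : j ≠ k) (hik : i ≠ k) (z w : ℂ) :
    elemSkew i j z * elemSkew j k w - elemSkew j k w * elemSkew i j z =
      elemSkew i k (z * w) := by
  simp [elemSkew, sub_mul, mul_sub, single_mul_single_of_ne, hij, hjk, hik, hij.symm, hjk.symm,
    hik.symm, mul_comm]

theorem elemSkew_bracket_self {i j : Fin N} (hij : i ≠ j) (r : ℝ) :
    elemSkew i j 1 * elemSkew i j ((r / 2 : ℝ) * Complex.I) -
        elemSkew i j ((r / 2 : ℝ) * Complex.I) * elemSkew i j 1 =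
      single i i (r * Complex.I) - single j j (r * Complex.I) := by
  have h : (r : ℂ) * Complex.I = (r / 2 : ℝ) * Complex.I + (r / 2 : ℝ) * Complex.I := by
    push_cast; ring
  rw [h, single_add, single_add]
  simp only [elemSkew, sub_mul, mul_sub, star_one, star_mul', Complex.star_def, Complex.conj_ofReal,
    Complex.conj_I, mul_neg, neg_mul, neg_zero, ← single_neg, single_mul_single_same, single_mul_single_of_ne, ne_eq,
    hij, hij.symm, not_false_eq_true, one_mul, mul_one, sub_zero, zero_sub]
  abel

/-- A skew-Hermitian matrix is the sum of its elementary skew-Hermitian parts. -/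
theorem sum_elemSkew {M : Matrix (Fin N) (Fin N) ℂ} (hM : Mᴴ = -M) :
    ∑ i, ∑ j, (1 / 2 : ℝ) • elemSkew i j (M i j) = M := by
  have h1 : ∑ i, ∑ j, single i j (M i j) = M := (matrix_eq_sum_single M).symm
  have h2 : ∑ i, ∑ j, single j i (star (M i j)) = -M := by
    rw [Finset.sum_comm, ← hM]
    exact (matrix_eq_sum_single Mᴴ).symm
  simp only [← Finset.smul_sum, elemSkew, Finset.sum_sub_distrib, h1, h2, sub_neg_eq_add]
  rw [← two_smul ℝ M, smul_smul]; norm_num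

/-- A Lie subalgebra that contains all elementary skew-Hermitian matrices contains `su(N)`. -/
theorem su_le_of_elemSkew_mem (W : Submodule ℝ (Matrix (Fin N) (Fin N) ℂ))
    (hW : ∀ x ∈ W, ∀ y ∈ W, x * y - y * x ∈ W) (o : Fin N)
    (h : ∀ i j, i ≠ j → ∀ z, elemSkew i j z ∈ W) : su N ≤ W := by
  rintro M ⟨hM, htr⟩
  have hre : ∀ i, ((M i i).im : ℂ) * Complex.I = M i i := fun i ↦ by
    have h1 : star (M i i) = - M i i := congrFun (congrFun hM i) i
    have h2 := congrArg Complex.re h1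
    simp at h2
    apply Complex.ext <;> simp; linarith
  have hdiag : ∀ i, single i i (M i i) - single o o (M i i) ∈ W := fun i ↦ by
    rcases eq_or_ne i o with rfl | hi
    · simp
    · rw [← hre i, ← elemSkew_bracket_self hi]
      exact hW _ (h _ _ hi _) _ (h _ _ hi _)
  have hself : ∀ i, (1 / 2 : ℝ) • elemSkew i i (M i i) = single i i (M i i) := fun i ↦ by
    have h1 : star (M i i) = - M i i := congrFun (congrFun hM i) i
    rw [elemSkew, h1, ← single_neg, sub_neg_eq_add, ← two_smul ℝ, smul_smul]; norm_num
  -- The corrections at `(o, o)` add up to the trace, which is zero; they make each diagonal term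
  -- traceless, hence a bracket of elementary matrices.
  have key : M = ∑ i, ((single i i (M i i) - single o o (M i i)) +
      ∑ j ∈ Finset.univ.erase i, (1 / 2 : ℝ) • elemSkew i j (M i j)) := by
    conv_lhs => rw [← sum_elemSkew hM]
    have h0 : ∑ i, single o o (M i i) = 0 := by
      have : ∑ i, single o o (M i i) = single o o (∑ i, M i i) :=
        
        (map_sum (singleAddMonoidHom (α := ℂ) o o) (fun i ↦ M i i) Finset.univ).symm
      rw [this]
      have : ∑ i, M i i = 0 := htr
      rw [this, single_zero]
    rw [Finset.sum_add_distrib, Finset.sum_sub_distrib, h0, sub_zero, ← Finset.sum_add_distrib]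
    refine Finset.sum_congr rfl fun i _ ↦ ?_
    rw [← Finset.add_sum_erase _ _ (Finset.mem_univ i), hself]
  rw [key]
  refine W.sum_mem fun i _ ↦ W.add_mem (hdiag i) (W.sum_mem fun j hj ↦ W.smul_mem _ ?_)
  exact h _ _ (Finset.ne_of_mem_erase hj).symm _

/-! ### Root components and generation of `su(N)` -/

theorem energy_mul {A : Matrix (Fin N) (Fin N) ℂ} (hA : A ∈ su N) (i : Fin N) :
    A i i = -(Complex.I * energy A i) := by
  have h1 : star (A i i) = - A i i := congrFun (congrFun hA.1 i) i
  have h2 := congrArg Complex.re h1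
  simp at h2
  apply Complex.ext <;> simp [energy]; linarith

/-- The adjoint action of a diagonal `A ∈ su(N)`, entrywise. -/
theorem bracket_diag_apply {A : Matrix (Fin N) (Fin N) ℂ} (hA : A ∈ su N) (hd : A.IsDiag)
    (Z : Matrix (Fin N) (Fin N) ℂ) (i j : Fin N) :
    (A * Z - Z * A) i j = Complex.I * rootValue A (i, j) * Z i j := by
  have h : A = diagonal fun i ↦ A i i := ((isDiag_iff_diagonal_diag A).1 hd).symm
  rw [Matrix.sub_apply]
  conv_lhs => rw [h]
  rw [diagonal_mul, mul_diagonal, energy_mul hA i, energy_mul hA j, rootValue]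
  push_cast; ring

/-- A subspace that is invariant under `ad A` is closed under multiplying the entry `(i, j)` of a
matrix by a real polynomial in `ω_ij ^ 2`. -/
theorem polynomial_rootValue_mem {A : Matrix (Fin N) (Fin N) ℂ} (hA : A ∈ su N) (hd : A.IsDiag)
    (W : Submodule ℝ (Matrix (Fin N) (Fin N) ℂ)) (hW : ∀ x ∈ W, A * x - x * A ∈ W)
    {Z : Matrix (Fin N) (Fin N) ℂ} (hZ : Z ∈ W) (p : Polynomial ℝ) :
    (of fun i j ↦ ((p.eval (rootValue A (i, j) ^ 2) : ℝ) : ℂ) * Z i j) ∈ W := by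
  induction p using Polynomial.induction_on' with
  | add p q hp hq =>
    convert W.add_mem hp hq using 1
    ext i j; simp [add_mul]
  | monomial n a =>
    induction n generalizing a with
    | zero =>
      convert W.smul_mem a hZ using 1
      ext i j; simp
    | succ n ih =>
      -- Two applications of `ad A` multiply an entry by `(iω)² = -ω²`; the coefficient `-a` absorbs
      -- the sign.
      convert hW _ (hW _ (ih (-a))) using 1
      ext i j
      rw [bracket_diag_apply hA hd, bracket_diag_apply hA hd]
      simp only [of_apply, Polynomial.eval_monomial]
      push_cast
      linear_combination (a * rootValue A (i, j) ^ (2 * n + 2) * Z i j : ℂ) * Complex.I_sq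

theorem rootValue_swap (A : Matrix (Fin N) (Fin N) ℂ) (i j : Fin N) :
    rootValue A (j, i) = -rootValue A (i, j) := by simp [rootValue]

theorem apply_swap {B : Matrix (Fin N) (Fin N) ℂ} (hB : B ∈ su N) (i j : Fin N) :
    B j i = -star (B i j) := by
  have h := congrFun (congrFun hB.1 j) i
  rw [conjTranspose_apply, Matrix.neg_apply] at h
  rw [h, neg_neg]

theorem rootValue_pos {A B : Matrix (Fin N) (Fin N) ℂ} (hord : Monotone (energy A))
    (hreg : IsRegularAlong A B) {p : Fin N × Fin N} (hp : p ∈ touchedRoots B) :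
    0 < rootValue A p :=
  lt_of_le_of_ne (sub_nonneg.2 (hord hp.1.le)) (hreg.1 p hp).symm

/-- The ordering makes touched positive roots take positive values, so squaring confuses a root only
with its negative, the transposed entry. Diagonal entries have value zero and are thereby excluded.
-/
theorem eq_or_swap_of_rootValue_sq_eq {A B : Matrix (Fin N) (Fin N) ℂ} (hB : B ∈ su N)
    (hord : Monotone (energy A)) (hreg : IsRegularAlong A B) {k l : Fin N}
    (hkl : (k, l) ∈ touchedRoots B) {i j : Fin N} (hb : B i j ≠ 0)
    (h : rootValue A (i, j) ^ 2 = rootValue A (k, l) ^ 2) :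
    (i = k ∧ j = l) ∨ (i = l ∧ j = k) := by
  have hpos := rootValue_pos hord hreg hkl
  rcases lt_trichotomy i j with hij | rfl | hij
  · have ht : (i, j) ∈ touchedRoots B := ⟨hij, hb⟩
    have := hreg.2 ht hkl ((sq_eq_sq₀ (rootValue_pos hord hreg ht).le hpos.le).1 h)
    exact Or.inl (Prod.mk.inj this)
  · have h0 : rootValue A (i, i) = 0 := by simp [rootValue]
    rw [h0] at h
    nlinarith
  · have ht : (j, i) ∈ touchedRoots B :=
      ⟨hij, fun h0 ↦ hb (by rw [apply_swap hB j i]; simp only [] at h0; rw [h0]; simp)⟩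
    rw [rootValue_swap A j i, neg_sq] at h
    have := Prod.mk.inj (hreg.2 ht hkl ((sq_eq_sq₀ (rootValue_pos hord hreg ht).le hpos.le).1 h))
    exact Or.inr ⟨this.2, this.1⟩

/-- A subspace containing `B` and invariant under `ad A` contains every elementary skew-Hermitian
matrix at a root touched by `B`. -/
theorem elemSkew_mem_of_touched {A B : Matrix (Fin N) (Fin N) ℂ} (hA : A ∈ su N) (hB : B ∈ su N)
    (hd : A.IsDiag) (hord : Monotone (energy A)) (hreg : IsRegularAlong A B)
    (W : Submodule ℝ (Matrix (Fin N) (Fin N) ℂ)) (hW : ∀ x ∈ W, A * x - x * A ∈ W) (hBW : B ∈ W)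
    {k l : Fin N} (hkl : (k, l) ∈ touchedRoots B) (z : ℂ) : elemSkew k l z ∈ W := by
  classical
  have hne : k ≠ l := hkl.1.ne
  have hb : B k l ≠ 0 := hkl.2
  have hpos := rootValue_pos hord hreg hkl
  -- The interpolating polynomial is `1` at the square of the chosen root value and `0` at all other
  -- squares, so it kills every entry of `B` except `(k, l)` and `(l, k)`.
  let s : Finset ℝ := Finset.univ.image fun p : Fin N × Fin N ↦ rootValue A p ^ 2
  let r : ℝ → ℝ := fun x ↦ if x = rootValue A (k, l) ^ 2 then 1 else 0
  let p := Lagrange.interpolate s id r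
  have hp : ∀ i j, p.eval (rootValue A (i, j) ^ 2) = r (rootValue A (i, j) ^ 2) := fun i j ↦
    Lagrange.eval_interpolate_at_node (s := s) (v := id) r (Set.injOn_id _)
      (Finset.mem_image_of_mem _ (Finset.mem_univ (i, j)))
  have h1 : elemSkew k l (B k l) ∈ W := by
    convert polynomial_rootValue_mem hA hd W hW hBW p using 1
    ext i j
    rw [of_apply, hp]
    by_cases hij : B i j = 0
    · have h1 : ¬ (k = i ∧ l = j) := by rintro ⟨rfl, rfl⟩; exact hb hij
      have h2 : ¬ (l = i ∧ k = j) := by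
        rintro ⟨rfl, rfl⟩
        rw [apply_swap hB k l] at hij
        exact hb (by simpa using hij)
      simp [elemSkew, hij, single_apply_of_ne _ _ _ _ _ h1, single_apply_of_ne _ _ _ _ _ h2]
    · by_cases he : rootValue A (i, j) ^ 2 = rootValue A (k, l) ^ 2
      · rcases eq_or_swap_of_rootValue_sq_eq hB hord hreg hkl hij he with ⟨rfl, rfl⟩ | ⟨rfl, rfl⟩
        · simp [elemSkew, r, hne.symm]
        · rw [apply_swap hB j i]
          simp [elemSkew, r, he, hne]
      · have h1 : ¬ (k = i ∧ l = j) := by rintro ⟨rfl, rfl⟩; exact he rfl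
        have h2 : ¬ (l = i ∧ k = j) := by
          rintro ⟨rfl, rfl⟩
          rw [rootValue_swap A k l, neg_sq] at he
          exact he rfl
        simp [elemSkew, r, he, single_apply_of_ne _ _ _ _ _ h1, single_apply_of_ne _ _ _ _ _ h2]
  -- One more `ad A` rotates the coefficient by `i`; the two coefficients form a real basis of `ℂ`.
  have h2 : elemSkew k l (Complex.I * B k l) ∈ W := by
    have h3 := W.smul_mem (rootValue A (k, l))⁻¹ (hW _ h1)
    convert h3 using 1
    have hc : (rootValue A (k, l) : ℂ) ≠ 0 := by exact_mod_cast hpos.ne'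
    ext i j
    rw [Matrix.smul_apply, bracket_diag_apply hA hd]
    by_cases h1 : k = i ∧ l = j
    · obtain ⟨rfl, rfl⟩ := h1
      simp [elemSkew, hne.symm]
      field_simp
    · by_cases h2 : l = i ∧ k = j
      · obtain ⟨rfl, rfl⟩ := h2
        rw [rootValue_swap A k l]
        simp [elemSkew, hne]
        field_simp
      · simp [elemSkew, single_apply_of_ne _ _ _ _ _ h1, single_apply_of_ne _ _ _ _ _ h2]
  have hz : z = (z / B k l).re • B k l + (z / B k l).im • (Complex.I * B k l) := by
    conv_lhs => rw [← div_mul_cancel₀ z hb, ← Complex.re_add_im (z / B k l)]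
    simp only [Complex.real_smul]
    ring
  rw [hz, elemSkew_add, elemSkew_smul, elemSkew_smul]
  exact W.add_mem (W.smul_mem _ h1) (W.smul_mem _ h2)

/-- `su(N)` is generated as a Lie algebra by `A` and `B`. -/
theorem su_le_of_mem {A B : Matrix (Fin N) (Fin N) ℂ} (hA : A ∈ su N) (hB : B ∈ su N)
    (hd : A.IsDiag) (hord : Monotone (energy A))
    (hconn : (matrixGraph B).toSimpleGraphInclusive.Connected) (hreg : IsRegularAlong A B)
    (W : Submodule ℝ (Matrix (Fin N) (Fin N) ℂ)) (hW : ∀ x ∈ W, ∀ y ∈ W, x * y - y * x ∈ W)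
    (hAW : A ∈ W) (hBW : B ∈ W) : su N ≤ W := by
  have hedge : ∀ i j, (matrixGraph B).toSimpleGraphInclusive.Adj i j →
      ∀ z, elemSkew i j z ∈ W := by
    intro i j hij z
    have hij' : i ≠ j := hij.ne
    have hb : B i j ≠ 0 := by
      rcases hij.2 with h | h
      · exact h
      · intro h0
        apply (show B j i ≠ 0 from h)
        rw [apply_swap hB i j, h0]; simp
    rcases lt_or_gt_of_ne hij' with h | h
    · exact elemSkew_mem_of_touched hA hB hd hord hreg W (hW A hAW) hBW ⟨h, hb⟩ z
    · rw [elemSkew_swap]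
      refine W.neg_mem (elemSkew_mem_of_touched hA hB hd hord hreg W (hW A hAW) hBW ⟨h, ?_⟩ _)
      intro h0
      apply hb
      rw [apply_swap hB j i, show B j i = 0 from h0]; simp
  -- Bracketing the first edge with the rest of the walk joins its ends. The alternative `i = j` is
  -- needed because a walk may revisit its endpoint.
  have hall : ∀ i j, (matrixGraph B).toSimpleGraphInclusive.Reachable i j →
      i = j ∨ ∀ z, elemSkew i j z ∈ W := by
    rintro i j ⟨w⟩
    induction w with
    | nil => exact Or.inl rfl
    | @cons a b c hab _ ih =>
      rcases eq_or_ne a c with hac | hac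
      · exact Or.inl hac
      · refine Or.inr fun z ↦ ?_
        rcases eq_or_ne b c with rfl | hbc
        · exact hedge _ _ hab z
        · have := hW _ (hedge _ _ hab z) _ (ih.resolve_left hbc 1)
          rwa [elemSkew_bracket hab.ne hbc hac, mul_one] at this
  obtain ⟨o⟩ := hconn.nonempty
  exact su_le_of_elemSkew_mem W hW o fun i j hij z ↦
    (hall i j (hconn.preconnected i j)).resolve_left hij z

/-! ### The exponential map and the topology of `SU(N)` -/

open NormedSpace Filter
open scoped Matrix.Norms.L2Operator Topology

theorem exp_neg_mul_exp (X : Matrix (Fin N) (Fin N) ℂ) : exp (-X) * exp X = 1 := by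
  rw [← Matrix.exp_add_of_commute _ _ (Commute.neg_left (Commute.refl X)), neg_add_cancel, exp_zero]

theorem exp_mul_exp_neg (X : Matrix (Fin N) (Fin N) ℂ) : exp X * exp (-X) = 1 := by
  simpa using exp_neg_mul_exp (-X)

theorem star_mul_self_eq_one (g : specialUnitaryGroup (Fin N) ℂ) :
    star (g : Matrix (Fin N) (Fin N) ℂ) * g = 1 := g.2.1.1

theorem self_mul_star_eq_one (g : specialUnitaryGroup (Fin N) ℂ) :
    (g : Matrix (Fin N) (Fin N) ℂ) * star (g : Matrix (Fin N) (Fin N) ℂ) = 1 := g.2.1.2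

theorem exp_conj_unitary {U : Matrix (Fin N) (Fin N) ℂ} (hU : U ∈ unitaryGroup (Fin N) ℂ)
    (X : Matrix (Fin N) (Fin N) ℂ) : exp (U * X * star U) = U * exp X * star U := by
  have h : U⁻¹ = star U := Matrix.inv_eq_left_inv hU.1
  have hu : IsUnit U := IsUnit.of_mul_eq_one _ hU.2
  rw [← h, Matrix.exp_conj _ _ hu]

theorem det_exp_diagonal (v : Fin N → ℂ) :
    (exp (diagonal v)).det = Complex.exp (diagonal v).trace := by
  rw [Matrix.exp_diagonal, det_diagonal, trace_diagonal, Complex.exp_sum]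
  refine Finset.prod_congr rfl fun i _ ↦ ?_
  rw [Pi.coe_exp, Complex.exp_eq_exp_ℂ]

theorem det_conj_unitary {U : Matrix (Fin N) (Fin N) ℂ} (hU : U ∈ unitaryGroup (Fin N) ℂ)
    (X : Matrix (Fin N) (Fin N) ℂ) : (U * X * star U).det = X.det := by
  rw [det_mul_right_comm, hU.2, one_mul]

theorem trace_conj_unitary {U : Matrix (Fin N) (Fin N) ℂ} (hU : U ∈ unitaryGroup (Fin N) ℂ)
    (X : Matrix (Fin N) (Fin N) ℂ) : (U * X * star U).trace = X.trace := by
  rw [trace_mul_comm, ← mul_assoc, hU.1, one_mul]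

/-- Jacobi's formula for skew-Hermitian matrices. -/
theorem det_exp_of_skew {X : Matrix (Fin N) (Fin N) ℂ} (hX : Xᴴ = -X) :
    (exp X).det = Complex.exp X.trace := by
  have hH : (Complex.I • X).IsHermitian := by
    rw [IsHermitian, conjTranspose_smul, hX]; simp
  have hs := hH.spectral_theorem
  rw [Unitary.conjStarAlgAut_apply] at hs
  set U := hH.eigenvectorUnitary
  set v : Fin N → ℂ := fun i ↦ -Complex.I * hH.eigenvalues i
  have hXs : X = U * diagonal v * star (U : Matrix (Fin N) (Fin N) ℂ) := by
    have h1 : X = (-Complex.I) • (Complex.I • X) := by rw [smul_smul]; simp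
    have h2 : diagonal v = (-Complex.I) • diagonal (RCLike.ofReal ∘ hH.eigenvalues) := by
      rw [← diagonal_smul]; rfl
    rw [h1, hs, h2, mul_smul_comm, smul_mul_assoc]
  rw [hXs, exp_conj_unitary U.2, det_conj_unitary U.2, trace_conj_unitary U.2, det_exp_diagonal]

theorem exp_mem_unitary_of_skew {X : Matrix (Fin N) (Fin N) ℂ} (hX : Xᴴ = -X) :
    exp X ∈ unitaryGroup (Fin N) ℂ := by
  have h : star (exp X) = exp (-X) := by rw [← hX, star_eq_conjTranspose, Matrix.exp_conjTranspose]
  refine ⟨?_, ?_⟩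
  · rw [h, exp_neg_mul_exp]
  · rw [h, exp_mul_exp_neg]

theorem exp_mem_specialUnitaryGroup {X : Matrix (Fin N) (Fin N) ℂ} (hX : X ∈ su N) :
    exp X ∈ specialUnitaryGroup (Fin N) ℂ := by
  refine mem_specialUnitaryGroup_iff.2 ⟨exp_mem_unitary_of_skew hX.1, ?_⟩
  rw [det_exp_of_skew hX.1, hX.2, Complex.exp_zero]

/-- The exponential map from `su(N)` to `SU(N)`. -/
noncomputable def expSU (X : su N) : specialUnitaryGroup (Fin N) ℂ :=
  ⟨exp (X : Matrix (Fin N) (Fin N) ℂ), exp_mem_specialUnitaryGroup X.2⟩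

theorem coe_expSU (X : su N) :
    (expSU X : Matrix (Fin N) (Fin N) ℂ) = exp (X : Matrix (Fin N) (Fin N) ℂ) := rfl

theorem conj_mem_su (g : specialUnitaryGroup (Fin N) ℂ) {X : Matrix (Fin N) (Fin N) ℂ}
    (hX : X ∈ su N) :
    (g : Matrix (Fin N) (Fin N) ℂ) * X * star (g : Matrix (Fin N) (Fin N) ℂ) ∈ su N := by
  refine ⟨?_, ?_⟩
  · have h : star X = -X := hX.1
    rw [← star_eq_conjTranspose, star_mul, star_mul, star_star, h]
    simp [mul_assoc]
  · rw [trace_conj_unitary g.2.1, hX.2]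

instance : IsTopologicalGroup (specialUnitaryGroup (Fin N) ℂ) where
  continuous_inv := by
    refine Continuous.subtype_mk ?_ _
    exact continuous_star.comp continuous_subtype_val

instance : CompactSpace (specialUnitaryGroup (Fin N) ℂ) := by
  have hc : IsClosed (specialUnitaryGroup (Fin N) ℂ : Set (Matrix (Fin N) (Fin N) ℂ)) := by
    have h : (specialUnitaryGroup (Fin N) ℂ : Set (Matrix (Fin N) (Fin N) ℂ)) =
        {M | star M * M = 1} ∩ {M | M * star M = 1} ∩ {M | M.det = 1} := by
      ext M; rfl
    rw [h]
    refine ((isClosed_eq (by fun_prop) (by fun_prop)).inter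
      (isClosed_eq (by fun_prop) (by fun_prop))).inter (isClosed_eq ?_ (by fun_prop))
    exact Continuous.matrix_det continuous_id
  have hp : IsCompact (Set.pi Set.univ fun _ : Fin N ↦ Set.pi Set.univ fun _ : Fin N ↦
      Metric.closedBall (0 : ℂ) 1) :=
    isCompact_univ_pi fun _ ↦ isCompact_univ_pi fun _ ↦ isCompact_closedBall _ _
  refine isCompact_iff_compactSpace.1 (IsCompact.of_isClosed_subset hp hc fun M hM i _ j _ ↦ ?_)
  rw [mem_closedBall_zero_iff]
  exact entry_norm_bound_of_unitary hM.1 i j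

/-- The exponential is injective near `0`. -/
theorem exists_nhds_injOn_exp :
    ∃ V ∈ 𝓝 (0 : Matrix (Fin N) (Fin N) ℂ), Set.InjOn exp V := by
  have h : HasStrictFDerivAt (exp : Matrix (Fin N) (Fin N) ℂ → Matrix (Fin N) (Fin N) ℂ)
      ((ContinuousLinearEquiv.refl ℝ (Matrix (Fin N) (Fin N) ℂ) :
        Matrix (Fin N) (Fin N) ℂ →L[ℝ] Matrix (Fin N) (Fin N) ℂ)) 0 :=
    hasStrictFDerivAt_exp_zero
  have hm : (0 : Matrix (Fin N) (Fin N) ℂ) ∈ (h.toOpenPartialHomeomorph exp).source :=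
    h.mem_toOpenPartialHomeomorph_source
  exact ⟨_, (h.toOpenPartialHomeomorph exp).open_source.mem_nhds hm,
    (h.toOpenPartialHomeomorph exp).injOn⟩

/-- Near `0`, only elements of `su(N)` have their exponential in `SU(N)`. -/
theorem eventually_mem_su_of_exp_mem :
    ∀ᶠ P in 𝓝 (0 : Matrix (Fin N) (Fin N) ℂ),
      exp P ∈ specialUnitaryGroup (Fin N) ℂ → P ∈ su N := by
  obtain ⟨V, hV, hinj⟩ := exists_nhds_injOn_exp (N := N)
  have h1 : ∀ᶠ P in 𝓝 (0 : Matrix (Fin N) (Fin N) ℂ), star P ∈ V :=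
    (continuous_star.tendsto' 0 0 (by simp)).eventually hV
  have h2 : ∀ᶠ P in 𝓝 (0 : Matrix (Fin N) (Fin N) ℂ), -P ∈ V :=
    (continuous_neg.tendsto' 0 0 (by simp)).eventually hV
  have ht : Continuous fun P : Matrix (Fin N) (Fin N) ℂ ↦ P.trace := by fun_prop
  have h3 : ∀ᶠ P in 𝓝 (0 : Matrix (Fin N) (Fin N) ℂ), P.trace ∈ Metric.ball (0 : ℂ) 1 :=
    (ht.tendsto' 0 0 (by simp)).eventually (Metric.ball_mem_nhds _ one_pos)
  filter_upwards [h1, h2, h3] with P hs hn htr hP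
  -- Both sides exponentiate to the inverse of `exp P` and lie where `exp` is injective.
  have hskew : Pᴴ = -P := by
    refine hinj hs hn ?_
    have h4 : star (exp P) * exp P = 1 := hP.1.1
    rw [← star_exp P]
    calc star (exp P) = star (exp P) * (exp P * exp (-P)) := by rw [exp_mul_exp_neg, mul_one]
      _ = exp (-P) := by rw [← mul_assoc, h4, one_mul]
  refine ⟨hskew, ?_⟩
  -- Determinant one puts the trace in `2πiℤ`; being small, it vanishes.
  have hdet := det_exp_of_skew hskew
  rw [show (exp P).det = 1 from hP.2] at hdet
  obtain ⟨n, hn⟩ := Complex.exp_eq_one_iff.1 hdet.symm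
  rcases eq_or_ne n 0 with rfl | hn0
  · simpa using hn
  · exfalso
    rw [mem_ball_zero_iff, hn] at htr
    have h5 : (1 : ℝ) ≤ |(n : ℝ)| := by exact_mod_cast Int.one_le_abs hn0
    simp [abs_of_pos Real.pi_pos] at htr
    nlinarith [Real.pi_gt_three]

/-- Every unitary matrix is the exponential of a skew-Hermitian one. -/
theorem exists_skew_exp_eq {U : Matrix (Fin N) (Fin N) ℂ} (hU : U ∈ unitaryGroup (Fin N) ℂ) :
    ∃ X : Matrix (Fin N) (Fin N) ℂ, Xᴴ = -X ∧ exp X = U := by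
  have hn : IsStarNormal U := ⟨hU.1.trans hU.2.symm⟩
  have hcont : ∀ f : ℂ → ℂ, ContinuousOn f (spectrum ℂ U) := fun f ↦
    (Matrix.finite_spectrum U).continuousOn f
  -- A discontinuous branch of the logarithm is allowed since the spectrum is finite.
  let f : ℂ → ℂ := fun z ↦ z.arg * Complex.I
  refine ⟨cfc f U, ?_, ?_⟩
  · rw [← star_eq_conjTranspose, ← cfc_star, ← cfc_neg]
    simp [f]
  · rw [← CFC.complex_exp_eq_normedSpace_exp (cfc_predicate f U),
      ← cfc_comp' Complex.exp f U (by fun_prop) (hcont f)]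
    conv_rhs => rw [← cfc_id ℂ U]
    refine cfc_congr fun z hz ↦ ?_
    have hz1 : ‖z‖ = 1 := by
      have := spectrum.subset_circle_of_unitary hU hz
      simpa using this
    have := Complex.norm_mul_exp_arg_mul_I z
    simpa [hz1, f] using this

/-- A subgroup of `SU(N)` that contains the exponentials of `su(N)` is the whole group. -/
theorem eq_top_of_expSU_mem [NeZero N] (K : Subgroup (specialUnitaryGroup (Fin N) ℂ))
    (hK : ∀ X : su N, expSU X ∈ K) : K = ⊤ := by
  refine (Subgroup.eq_top_iff' K).2 fun g ↦ ?_
  obtain ⟨X, hX, hXg⟩ := exists_skew_exp_eq g.2.1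
  have hdet := det_exp_of_skew hX
  rw [hXg, show (g : Matrix (Fin N) (Fin N) ℂ).det = 1 from g.2.2] at hdet
  obtain ⟨n, hn⟩ := Complex.exp_eq_one_iff.1 hdet.symm
  have hN : (N : ℂ) ≠ 0 := by exact_mod_cast NeZero.ne N
  set c : ℂ := n * (2 * Real.pi * Complex.I) with hc
  have hcs : star c = -c := by simp [hc]
  have hcN : star (c / N) = -(c / N) := by rw [star_div₀, hcs, neg_div]; simp
  -- The trace `c` of `X` may be a nonzero multiple of `2πi`. Split off the scalar `c / N`, then
  -- lower one of its entries by `c`: both pieces become traceless and, as `exp c = 1`, the product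
  -- is unchanged.
  set Y : Matrix (Fin N) (Fin N) ℂ := X - diagonal fun _ ↦ c / N
  set v : Fin N → ℂ := fun i ↦ c / N - if i = 0 then c else 0
  have hY : Y ∈ su N := by
    refine ⟨?_, ?_⟩
    · rw [conjTranspose_sub, hX, diagonal_conjTranspose, neg_sub', sub_neg_eq_add]
      have : star (fun _ : Fin N ↦ c / N) = fun _ ↦ -(c / N) := by ext1 i; exact hcN
      rw [this, ← diagonal_neg, sub_neg_eq_add]
    · rw [trace_sub, trace_diagonal, hn]
      simp [mul_div_cancel₀, hN]
  have hv : diagonal v ∈ su N := by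
    refine ⟨?_, ?_⟩
    · rw [diagonal_conjTranspose, diagonal_neg]
      congr 1
      ext1 i
      simp only [Pi.star_apply, v, star_sub, hcN]
      split_ifs <;> (simp [hcs]; try ring)
    · rw [trace_diagonal]
      simp [v, Finset.sum_sub_distrib]
      field_simp
      simp
  have hmul : g = expSU ⟨Y, hY⟩ * expSU ⟨_, hv⟩ := by
    apply Subtype.ext
    change (g : Matrix (Fin N) (Fin N) ℂ) = exp Y * exp (diagonal v)
    have h1 : exp (diagonal v) = exp (diagonal fun _ : Fin N ↦ c / N) := by
      rw [Matrix.exp_diagonal, Matrix.exp_diagonal]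
      congr 1
      ext1 i
      rw [Pi.coe_exp, Pi.coe_exp, ← Complex.exp_eq_exp_ℂ]
      simp only [v]
      split_ifs
      · rw [Complex.exp_sub, hc, Complex.exp_int_mul_two_pi_mul_I, div_one]
      · rw [sub_zero]
    rw [h1, ← Matrix.exp_add_of_commute, sub_add_cancel, hXg]
    have : (diagonal fun _ : Fin N ↦ c / N) = scalar (Fin N) (c / N) := rfl
    rw [this]
    exact (scalar_commute _ (Commute.all _) _).symm
  rw [hmul]
  exact K.mul_mem (hK _) (hK _)

theorem mem_of_hasDerivAt {E : Type*} [NormedAddCommGroup E] [NormedSpace ℝ E]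
    [FiniteDimensional ℝ E] (W : Submodule ℝ E) {f : ℝ → E} {f' : E} {t : ℝ}
    (hf : HasDerivAt f f' t) (hW : ∀ s, f s ∈ W) : f' ∈ W := by
  refine W.closed_of_finiteDimensional.mem_of_tendsto hf.tendsto_slope
    (Eventually.of_forall fun s ↦ ?_)
  exact W.smul_mem _ (W.sub_mem (hW s) (hW t))

/-- A dense submonoid with an interior point is the whole group. -/
theorem submonoid_eq_top_of_dense {G : Type*} [Group G] [TopologicalSpace G] [IsTopologicalGroup G]
    {S : Submonoid G} (hS : Dense (S : Set G)) {y : G} (hy : (S : Set G) ∈ 𝓝 y) : S = ⊤ := by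
  refine (Submonoid.eq_top_iff' _).2 fun g ↦ ?_
  -- The open set of `s` with `s⁻¹ g` interior to `S` contains `g y⁻¹`, so it meets `S`; then `g = s
  -- (s⁻¹ g)`.
  have hO : IsOpen ((fun s : G ↦ s⁻¹ * g) ⁻¹' interior (S : Set G)) :=
    isOpen_interior.preimage (by fun_prop)
  obtain ⟨s, hs, hsS⟩ := hS.inter_open_nonempty _ hO
    ⟨g * y⁻¹, by simpa [mem_interior_iff_mem_nhds] using hy⟩
  have := S.mul_mem hsS (interior_subset hs)
  rwa [mul_inv_cancel_left] at this

/-! ### Semigroup of forward flows and its Lie algebra -/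

/-- The elements `exp (t C)`, `t ≥ 0`, `C ∈ 𝒞`, of `SU(N)`. -/
def forwardFlows (𝒞 : Set (Matrix (Fin N) (Fin N) ℂ)) : Set (specialUnitaryGroup (Fin N) ℂ) :=
  {g | ∃ C ∈ 𝒞, ∃ t : ℝ, 0 ≤ t ∧ (g : Matrix (Fin N) (Fin N) ℂ) = exp (t • C)}

/-- The semigroup generated by the forward flows. -/
def flowMonoid (𝒞 : Set (Matrix (Fin N) (Fin N) ℂ)) : Submonoid (specialUnitaryGroup (Fin N) ℂ) :=
  Submonoid.closure (forwardFlows 𝒞)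

/-- The closed subgroup generated by the forward flows. -/
noncomputable def flowGroup (𝒞 : Set (Matrix (Fin N) (Fin N) ℂ)) : Subgroup (specialUnitaryGroup (Fin N) ℂ) :=
  (Subgroup.closure (forwardFlows 𝒞)).topologicalClosure

/-- In a compact group inverses are limits of positive powers, so backward flows are available in
the closure. -/
theorem closure_flowMonoid (𝒞 : Set (Matrix (Fin N) (Fin N) ℂ)) :
    closure (flowMonoid 𝒞 : Set (specialUnitaryGroup (Fin N) ℂ)) = flowGroup 𝒞 :=
  closure_submonoidClosure_eq_closure_subgroupClosure _

theorem flowMonoid_subset_flowGroup (𝒞 : Set (Matrix (Fin N) (Fin N) ℂ)) :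
    (flowMonoid 𝒞 : Set (specialUnitaryGroup (Fin N) ℂ)) ⊆ flowGroup 𝒞 := by
  rw [← closure_flowMonoid]; exact subset_closure

theorem expSU_mem_flowMonoid {𝒞 : Set (Matrix (Fin N) (Fin N) ℂ)} {C : su N}
    (hC : (C : Matrix (Fin N) (Fin N) ℂ) ∈ 𝒞) {t : ℝ} (ht : 0 ≤ t) :
    expSU (t • C) ∈ flowMonoid 𝒞 :=
  Submonoid.subset_closure ⟨C, hC, t, ht, rfl⟩

theorem expSU_neg (X : su N) : expSU (-X) = (expSU X)⁻¹ :=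
  eq_inv_of_mul_eq_one_left (Subtype.ext (exp_neg_mul_exp _))

theorem expSU_mem_flowGroup {𝒞 : Set (Matrix (Fin N) (Fin N) ℂ)} {C : su N}
    (hC : (C : Matrix (Fin N) (Fin N) ℂ) ∈ 𝒞) (t : ℝ) : expSU (t • C) ∈ flowGroup 𝒞 := by
  rcases le_total 0 t with ht | ht
  · exact flowMonoid_subset_flowGroup 𝒞 (expSU_mem_flowMonoid hC ht)
  · have h := flowMonoid_subset_flowGroup 𝒞
      (expSU_mem_flowMonoid hC (neg_nonneg.2 ht))
    rw [show (-t) • C = -(t • C) from neg_smul t C, expSU_neg] at h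
    exact (flowGroup 𝒞).inv_mem_iff.1 h

/-- The span of the conjugates of `𝒞` under the closed group generated by its flows. -/
noncomputable def orbitSpan (𝒞 : Set (Matrix (Fin N) (Fin N) ℂ)) : Submodule ℝ (Matrix (Fin N) (Fin N) ℂ) :=
  Submodule.span ℝ {x | ∃ g ∈ flowGroup 𝒞, ∃ C ∈ 𝒞,
    x = (g : Matrix (Fin N) (Fin N) ℂ) * C * star (g : Matrix (Fin N) (Fin N) ℂ)}

theorem subset_orbitSpan (𝒞 : Set (Matrix (Fin N) (Fin N) ℂ)) : 𝒞 ⊆ orbitSpan 𝒞 := fun C hC ↦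
  Submodule.subset_span ⟨1, (flowGroup 𝒞).one_mem, C, hC, by simp⟩

theorem conj_mem_orbitSpan {𝒞 : Set (Matrix (Fin N) (Fin N) ℂ)}
    {g : specialUnitaryGroup (Fin N) ℂ} (hg : g ∈ flowGroup 𝒞) {x : Matrix (Fin N) (Fin N) ℂ}
    (hx : x ∈ orbitSpan 𝒞) :
    (g : Matrix (Fin N) (Fin N) ℂ) * x * star (g : Matrix (Fin N) (Fin N) ℂ) ∈ orbitSpan 𝒞 := by
  induction hx using Submodule.span_induction with
  | mem x hx =>
    obtain ⟨k, hk, C, hC, rfl⟩ := hx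
    refine Submodule.subset_span ⟨g * k, (flowGroup 𝒞).mul_mem hg hk, C, hC, ?_⟩
    simp [mul_assoc]
  | zero => simp
  | add x y _ _ hx hy => simpa [mul_add, add_mul] using Submodule.add_mem _ hx hy
  | smul a x _ hx => simpa using Submodule.smul_mem _ a hx

/-- For `Z = g C g⁻¹`, the curve `exp (tZ) y exp (-tZ)` stays in the span, because `exp (tZ) = g exp
(tC) g⁻¹` is in the group for every real `t`. Its derivative at `0` is the bracket. -/
theorem bracket_mem_orbitSpan {𝒞 : Set (Matrix (Fin N) (Fin N) ℂ)}
    (h𝒞 : 𝒞 ⊆ su N) {x : Matrix (Fin N) (Fin N) ℂ} (hx : x ∈ orbitSpan 𝒞)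
    {y : Matrix (Fin N) (Fin N) ℂ} (hy : y ∈ orbitSpan 𝒞) : x * y - y * x ∈ orbitSpan 𝒞 := by
  induction hx using Submodule.span_induction with
  | mem x hx =>
    obtain ⟨g, hg, C, hC, rfl⟩ := hx
    set Z := (g : Matrix (Fin N) (Fin N) ℂ) * C * star (g : Matrix (Fin N) (Fin N) ℂ) with hZ
    have hmem : ∀ t : ℝ, exp (t • Z) * y * exp (t • -Z) ∈ orbitSpan 𝒞 := fun t ↦ by
      have h1 := expSU_mem_flowGroup (C := ⟨C, h𝒞 hC⟩) hC t
      have h2 := (flowGroup 𝒞).mul_mem ((flowGroup 𝒞).mul_mem hg h1) ((flowGroup 𝒞).inv_mem hg)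
      have h3 := conj_mem_orbitSpan h2 hy
      have h4 : ((g * expSU (t • ⟨C, h𝒞 hC⟩) * g⁻¹ : specialUnitaryGroup (Fin N) ℂ) :
          Matrix (Fin N) (Fin N) ℂ) = exp (t • Z) := by
        change (g : Matrix (Fin N) (Fin N) ℂ) * exp (t • C) *
          star (g : Matrix (Fin N) (Fin N) ℂ) = _
        rw [hZ, ← exp_conj_unitary g.2.1, mul_smul_comm, smul_mul_assoc]
      have hZs : star Z = -Z := (conj_mem_su g (h𝒞 hC)).1
      rw [h4, star_exp, star_smul, hZs, star_trivial] at h3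
      exact h3
    have hd : HasDerivAt (fun t : ℝ ↦ exp (t • Z) * y * exp (t • -Z)) (Z * y - y * Z) 0 := by
      have h1 := hasDerivAt_exp_smul_const (𝕂 := ℝ) Z 0
      have h2 := hasDerivAt_exp_smul_const (𝕂 := ℝ) (-Z) 0
      have h3 := (h1.mul_const y).mul h2
      refine h3.congr_deriv ?_
      simp only [zero_smul, exp_zero, one_mul, mul_one, mul_neg, sub_eq_add_neg]
    exact mem_of_hasDerivAt _ hd hmem
  | zero => simp
  | add a b _ _ ha hb =>
    convert Submodule.add_mem _ ha hb using 1
    rw [add_mul, mul_add]; abel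
  | smul r a _ ha =>
    convert Submodule.smul_mem _ r ha using 1
    rw [smul_mul_assoc, mul_smul_comm, smul_sub]

/-! ### Velocity spaces and interior points -/

/-- `L` is the space of right-translated velocities, at some point, of a family of elements of the
semigroup of `𝒞`. -/
def IsVelocitySpace (𝒞 : Set (Matrix (Fin N) (Fin N) ℂ))
    (L : Submodule ℝ (Matrix (Fin N) (Fin N) ℂ)) : Prop :=
  ∃ (E : Type) (_ : NormedAddCommGroup E) (_ : NormedSpace ℝ E) (_ : CompleteSpace E)
    (f : E → specialUnitaryGroup (Fin N) ℂ) (p : E) (R : E →L[ℝ] Matrix (Fin N) (Fin N) ℂ),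
    (∀ᶠ x in 𝓝 p, f x ∈ flowMonoid 𝒞) ∧
    HasStrictFDerivAt (fun x ↦ (f x : Matrix (Fin N) (Fin N) ℂ))
      (((ContinuousLinearMap.mul ℝ (Matrix (Fin N) (Fin N) ℂ)).flip (f p)).comp R) p ∧
    R.range = L

theorem isVelocitySpace_bot (𝒞 : Set (Matrix (Fin N) (Fin N) ℂ)) : IsVelocitySpace 𝒞 ⊥ := by
  refine ⟨ℝ, inferInstance, inferInstance, inferInstance, fun _ ↦ 1, 0, 0,
    Eventually.of_forall fun _ ↦ (flowMonoid 𝒞).one_mem, ?_, ?_⟩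
  · simpa using hasStrictFDerivAt_const (𝕜 := ℝ) (1 : Matrix (Fin N) (Fin N) ℂ) (0 : ℝ)
  · simp

/-- A velocity space that does not contain the orbit span can be enlarged. -/
theorem IsVelocitySpace.exists_lt {𝒞 : Set (Matrix (Fin N) (Fin N) ℂ)} (h𝒞 : 𝒞 ⊆ su N)
    {L : Submodule ℝ (Matrix (Fin N) (Fin N) ℂ)} (hL : IsVelocitySpace 𝒞 L)
    (hW : ¬ orbitSpan 𝒞 ≤ L) : ∃ L', IsVelocitySpace 𝒞 L' ∧ L < L' := by
  obtain ⟨E, _, _, _, f, p, R, hfS, hf, rfl⟩ := hL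
  have hp : f p ∈ flowMonoid 𝒞 := hfS.self_of_nhds
  obtain ⟨s, hs, C, hC, hnot⟩ : ∃ s ∈ flowMonoid 𝒞, ∃ C ∈ 𝒞,
      ((f p * s : specialUnitaryGroup (Fin N) ℂ) : Matrix (Fin N) (Fin N) ℂ) * C *
        star ((f p * s : specialUnitaryGroup (Fin N) ℂ) : Matrix (Fin N) (Fin N) ℂ) ∉
          R.range := by
    -- Membership in the range is a closed condition on `s`, so it would pass from the semigroup to
    -- its closure, a group in which `f p * s` takes every value `g`.
    by_contra! hcon
    refine hW (Submodule.span_le.2 ?_)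
    rintro _ ⟨g, hg, C, hC, rfl⟩
    have hcl : IsClosed {s : specialUnitaryGroup (Fin N) ℂ |
        ((f p * s : specialUnitaryGroup (Fin N) ℂ) : Matrix (Fin N) (Fin N) ℂ) * C *
        star ((f p * s : specialUnitaryGroup (Fin N) ℂ) : Matrix (Fin N) (Fin N) ℂ) ∈
          R.range} := by
      refine (Submodule.closed_of_finiteDimensional R.range).preimage (f := fun s ↦
        ((f p * s : specialUnitaryGroup (Fin N) ℂ) : Matrix (Fin N) (Fin N) ℂ) * C *
        star ((f p * s : specialUnitaryGroup (Fin N) ℂ) : Matrix (Fin N) (Fin N) ℂ)) ?_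
      fun_prop
    have hmem : (f p)⁻¹ * g ∈ closure (flowMonoid 𝒞 : Set (specialUnitaryGroup (Fin N) ℂ)) := by
      rw [closure_flowMonoid]
      exact (flowGroup 𝒞).mul_mem
        ((flowGroup 𝒞).inv_mem (flowMonoid_subset_flowGroup 𝒞 hp)) hg
    have h := hcl.closure_subset_iff.2 (fun s hs ↦ hcon s hs C hC) hmem
    change ((f p * ((f p)⁻¹ * g) : specialUnitaryGroup (Fin N) ℂ) : Matrix (Fin N) (Fin N) ℂ) * C *
      star ((f p * ((f p)⁻¹ * g) : specialUnitaryGroup (Fin N) ℂ) : Matrix (Fin N) (Fin N) ℂ) ∈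
        R.range at h
    rwa [mul_inv_cancel_left] at h
  set k : specialUnitaryGroup (Fin N) ℂ := f p * s with hk
  set Z := (k : Matrix (Fin N) (Fin N) ℂ) * C * star (k : Matrix (Fin N) (Fin N) ℂ) with hZ
  -- Appending `s` and a flow of `C` on the right keeps the old right-translated velocities and adds
  -- `Z`, since `C` commutes with its flow. The base time `1` is positive, so nearby times are
  -- admissible.
  let R' : E × ℝ →L[ℝ] Matrix (Fin N) (Fin N) ℂ :=
    R.coprod (ContinuousLinearMap.toSpanSingleton ℝ Z)
  refine ⟨R'.range, ⟨E × ℝ, inferInstance, inferInstance, inferInstance,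
    fun x ↦ f x.1 * s * expSU (x.2 • ⟨C, h𝒞 hC⟩), (p, 1), R', ?_, ?_, rfl⟩, ?_⟩
  · have h1 : ∀ᶠ x : E × ℝ in 𝓝 (p, 1), f x.1 ∈ flowMonoid 𝒞 :=
      (continuous_fst.tendsto (p, (1 : ℝ))).eventually hfS
    have h2 : ∀ᶠ x : E × ℝ in 𝓝 (p, 1), 0 < x.2 :=
      (continuous_snd.tendsto (p, (1 : ℝ))).eventually (lt_mem_nhds one_pos)
    filter_upwards [h1, h2] with x hx1 hx2
    exact mul_mem (mul_mem hx1 hs) (expSU_mem_flowMonoid hC hx2.le)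
  · have h1 : HasStrictFDerivAt (fun x : E × ℝ ↦ (f x.1 : Matrix (Fin N) (Fin N) ℂ)) _ (p, 1) :=
      HasStrictFDerivAt.comp (p, (1 : ℝ))
        (g := fun x ↦ (f x : Matrix (Fin N) (Fin N) ℂ)) hf hasStrictFDerivAt_fst
    have h2 : HasStrictFDerivAt (fun x : E × ℝ ↦ exp (x.2 • C)) _ (p, 1) :=
      HasStrictFDerivAt.comp (p, (1 : ℝ)) (g := fun t : ℝ ↦ exp (t • C))
        (hasStrictDerivAt_exp_smul_const' (𝕂 := ℝ) C 1).hasStrictFDerivAt hasStrictFDerivAt_snd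
    have h3 := (h1.mul_const' (s : Matrix (Fin N) (Fin N) ℂ)).mul' h2
    refine h3.congr_fderiv ?_
    have hZk : Z * k = k * C := by rw [hZ, mul_assoc, star_mul_self_eq_one, mul_one]
    refine ContinuousLinearMap.ext fun v ↦ ?_
    change (k : Matrix (Fin N) (Fin N) ℂ) * (v.2 • (C * exp ((1 : ℝ) • C))) +
        R v.1 * (f p : Matrix (Fin N) (Fin N) ℂ) * s * exp ((1 : ℝ) • C) =
      (R v.1 + v.2 • Z) * (k * exp ((1 : ℝ) • C))
    rw [add_mul, smul_mul_assoc, ← mul_assoc Z, hZk, mul_smul_comm, mul_assoc (k : Matrix _ _ ℂ) C,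
      hk, Submonoid.coe_mul, add_comm]
    simp only [mul_assoc]
  · refine lt_of_le_of_ne ?_ fun h ↦ hnot ?_
    · rintro _ ⟨v, rfl⟩
      exact ⟨(v, 0), by simp [R']⟩
    · rw [h]
      exact ⟨(0, 1), by simp [R']⟩

/-- Some velocity space contains the orbit span. -/
theorem exists_isVelocitySpace_orbitSpan_le {𝒞 : Set (Matrix (Fin N) (Fin N) ℂ)}
    (h𝒞 : 𝒞 ⊆ su N) : ∃ L, IsVelocitySpace 𝒞 L ∧ orbitSpan 𝒞 ≤ L := by
  obtain ⟨L, hL⟩ := exists_maximal_of_wellFoundedGT (IsVelocitySpace 𝒞) ⟨_, isVelocitySpace_bot 𝒞⟩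
  refine ⟨L, hL.1, ?_⟩
  by_contra hW
  obtain ⟨L', hL', hlt⟩ := hL.1.exists_lt h𝒞 hW
  exact hlt.not_ge (hL.2 hL' hlt.le)

/-- If a velocity space contains `su(N)`, the semigroup has an interior point. -/
theorem IsVelocitySpace.exists_mem_nhds {𝒞 : Set (Matrix (Fin N) (Fin N) ℂ)}
    {L : Submodule ℝ (Matrix (Fin N) (Fin N) ℂ)} (hL : IsVelocitySpace 𝒞 L) (hsu : su N ≤ L) :
    ∃ y, (flowMonoid 𝒞 : Set (specialUnitaryGroup (Fin N) ℂ)) ∈ 𝓝 y := by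
  obtain ⟨E, _, _, _, f, p, R, hfS, hf, rfl⟩ := hL
  obtain ⟨Q, hQ⟩ := Submodule.exists_isCompl (su N)
  -- The factor `exp Q`, transverse to `SU(N)`, makes the derivative onto all matrices. Where `Φ`
  -- lands in `SU(N)` near the base point, the `Q` component lies in `su N ⊓ Q = ⊥`.
  let Φ : E × Q → Matrix (Fin N) (Fin N) ℂ :=
    fun x ↦ exp (x.2 : Matrix (Fin N) (Fin N) ℂ) * f x.1
  have h1 : HasStrictFDerivAt (fun x : E × Q ↦ (f x.1 : Matrix (Fin N) (Fin N) ℂ)) _ (p, 0) :=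
    HasStrictFDerivAt.comp (p, (0 : Q))
      (g := fun x ↦ (f x : Matrix (Fin N) (Fin N) ℂ)) hf hasStrictFDerivAt_fst
  have h2 : HasStrictFDerivAt (fun x : E × Q ↦ exp (x.2 : Matrix (Fin N) (Fin N) ℂ))
      (Q.subtypeL.comp (ContinuousLinearMap.snd ℝ E Q)) (p, 0) :=
    HasStrictFDerivAt.comp (p, (0 : Q)) (f := fun x : E × Q ↦ (x.2 : Matrix (Fin N) (Fin N) ℂ))
      (g := exp) (g' := (1 : Matrix (Fin N) (Fin N) ℂ →L[ℝ] Matrix (Fin N) (Fin N) ℂ))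
      hasStrictFDerivAt_exp_zero (Q.subtypeL.comp (ContinuousLinearMap.snd ℝ E Q)).hasStrictFDerivAt
  have hΦ := h2.mul' h1
  have hmap := hΦ.map_nhds_eq_of_surj (by
    refine LinearMap.range_eq_top.2 fun Y ↦ ?_
    have hY : Y * star (f p : Matrix (Fin N) (Fin N) ℂ) ∈ su N ⊔ Q := by
      rw [hQ.sup_eq_top]; trivial
    obtain ⟨X, hX, P, hP, hXP⟩ := Submodule.mem_sup.1 hY
    obtain ⟨v, hv⟩ := hsu hX
    have hv' : R v = X := hv
    refine ⟨(v, ⟨P, hP⟩), ?_⟩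
    simp [hv']
    rw [← add_mul, hXP, mul_assoc, star_mul_self_eq_one, mul_one])
  refine ⟨f p, ?_⟩
  have hev : ∀ᶠ x : E × Q in 𝓝 (p, 0), f x.1 ∈ flowMonoid 𝒞 ∧
      (exp (x.2 : Matrix (Fin N) (Fin N) ℂ) ∈ specialUnitaryGroup (Fin N) ℂ →
        (x.2 : Matrix (Fin N) (Fin N) ℂ) ∈ su N) := by
    refine ((continuous_fst.tendsto (p, (0 : Q))).eventually hfS).and ?_
    have hc : Continuous fun x : E × Q ↦ (x.2 : Matrix (Fin N) (Fin N) ℂ) := by fun_prop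
    exact (hc.tendsto' (p, 0) 0 rfl).eventually eventually_mem_su_of_exp_mem
  have him := image_mem_map (m := Φ) hev
  change _ ∈ Filter.map Φ _ at him
  have hmap' : Filter.map Φ (𝓝 (p, 0)) = 𝓝 (f p : Matrix (Fin N) (Fin N) ℂ) := by
    have h : Filter.map Φ (𝓝 (p, 0)) =
        𝓝 (exp (0 : Matrix (Fin N) (Fin N) ℂ) * (f p : Matrix (Fin N) (Fin N) ℂ)) := hmap
    rwa [exp_zero, one_mul] at h
  rw [hmap'] at him
  filter_upwards [continuous_subtype_val.continuousAt.preimage_mem_nhds him] with y hy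
  obtain ⟨⟨x, P⟩, ⟨hx, hP⟩, hxy⟩ := hy
  have hxy' : exp (P : Matrix (Fin N) (Fin N) ℂ) * f x = y := hxy
  have hexp : exp (P : Matrix (Fin N) (Fin N) ℂ) = (y * (f x)⁻¹ : specialUnitaryGroup (Fin N) ℂ) := by
    change _ = (y : Matrix (Fin N) (Fin N) ℂ) * star (f x : Matrix (Fin N) (Fin N) ℂ)
    rw [← hxy', mul_assoc, self_mul_star_eq_one, mul_one]
  have hP0 : (P : Matrix (Fin N) (Fin N) ℂ) = 0 :=
    Submodule.disjoint_def.1 hQ.disjoint _ (hP (hexp ▸ Subtype.prop _)) P.2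
  have hyx : y = f x := Subtype.ext (by rw [← hxy', hP0, exp_zero, one_mul])
  rw [hyx]
  exact hx

/-- If the semigroup has an interior point, it is the whole of `SU(N)`. -/
theorem flowMonoid_eq_top [NeZero N] {𝒞 : Set (Matrix (Fin N) (Fin N) ℂ)}
    {y : specialUnitaryGroup (Fin N) ℂ}
    (hy : (flowMonoid 𝒞 : Set (specialUnitaryGroup (Fin N) ℂ)) ∈ 𝓝 y) : flowMonoid 𝒞 = ⊤ := by
  have hopen : IsOpen (flowGroup 𝒞 : Set (specialUnitaryGroup (Fin N) ℂ)) :=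
    Subgroup.isOpen_of_mem_nhds _ (mem_of_superset hy (flowMonoid_subset_flowGroup 𝒞))
  have htop : flowGroup 𝒞 = ⊤ := by
    refine eq_top_of_expSU_mem _ fun X ↦ ?_
    have hc : Continuous fun t : ℝ ↦ expSU (t • X) := by
      refine Continuous.subtype_mk ?_ _
      exact (differentiable_exp_smul_const ℝ (X : Matrix (Fin N) (Fin N) ℂ)).continuous
    have h0 : expSU ((0 : ℝ) • X) = 1 := by
      apply Subtype.ext
      rw [coe_expSU, zero_smul]
      exact exp_zero
    -- An open subgroup contains `exp (X / (n + 1))` for some `n`, hence its power `exp X`.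
    have h1 : Tendsto (fun n : ℕ ↦ expSU ((1 / ((n : ℝ) + 1)) • X)) atTop (𝓝 1) := by
      rw [← h0]
      exact (hc.tendsto 0).comp tendsto_one_div_add_atTop_nhds_zero_nat
    obtain ⟨n, hn⟩ := (h1.eventually (hopen.mem_nhds (flowGroup 𝒞).one_mem)).exists
    have hpow : expSU X = expSU ((1 / ((n : ℝ) + 1)) • X) ^ (n + 1) := by
      apply Subtype.ext
      rw [SubmonoidClass.coe_pow, coe_expSU, coe_expSU, ← Matrix.exp_nsmul, Submodule.coe_smul,
        ← Nat.cast_smul_eq_nsmul ℝ, smul_smul]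
      congr 1
      have : ((n : ℝ) + 1) ≠ 0 := by positivity
      push_cast
      rw [mul_one_div_cancel this, one_smul]
    rw [hpow]
    exact (flowGroup 𝒞).pow_mem hn _
  have hdense : Dense (flowMonoid 𝒞 : Set (specialUnitaryGroup (Fin N) ℂ)) := by
    rw [dense_iff_closure_eq, closure_flowMonoid, htop, Subgroup.coe_top]
  exact submonoid_eq_top_of_dense hdense hy

/-! ### Realisation by piecewise constant inputs -/

theorem hasDerivAt_matrix_apply {f : ℝ → Matrix (Fin N) (Fin N) ℂ}
    {f' : Matrix (Fin N) (Fin N) ℂ} {t : ℝ} (hf : HasDerivAt f f' t) (i j : Fin N) :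
    HasDerivAt (fun s ↦ f s i j) (f' i j) t := by
  let ℓ : Matrix (Fin N) (Fin N) ℂ →ₗ[ℝ] ℂ := Matrix.entryLinearMap ℝ ℂ i j
  exact (LinearMap.toContinuousLinearMap ℓ).hasFDerivAt.comp_hasDerivAt t hf

theorem one_mem_reachableSet (A B : Matrix (Fin N) (Fin N) ℂ) : 1 ∈ reachableSet A B := by
  refine ⟨0, le_rfl, fun _ ↦ 0, ∅, fun _ ↦ 1, fun _ _ _ _ ↦ rfl, ⟨rfl, continuousOn_const, ?_⟩, rfl⟩
  intro t ht
  exact absurd ht (by simp)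

/-- Following a constant input for a time `t` after reaching `y` stays in the reachable set. -/
theorem exp_mul_mem_reachableSet {A B : Matrix (Fin N) (Fin N) ℂ} (hA : A ∈ su N) (hB : B ∈ su N)
    {y g : specialUnitaryGroup (Fin N) ℂ} (hy : y ∈ reachableSet A B) (c : ℝ) {t : ℝ} (ht : 0 ≤ t)
    (hg : (g : Matrix (Fin N) (Fin N) ℂ) = exp (t • (A + c • B))) :
    g * y ∈ reachableSet A B := by
  classical
  obtain ⟨T, hT, u, D, X, hu, ⟨hX0, hXc, hXd⟩, rfl⟩ := hy
  set C : su N := ⟨A + c • B, (su N).add_mem hA ((su N).smul_mem c hB)⟩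
  have hflow : Continuous fun s : ℝ ↦ expSU ((s - T) • C) * X T := by
    refine Continuous.mul (Continuous.subtype_mk ?_ _) continuous_const
    exact (differentiable_exp_smul_const ℝ (C : Matrix (Fin N) (Fin N) ℂ)).continuous.comp
      (continuous_id.sub continuous_const)
  have hflowT : expSU ((T - T) • C) * X T = X T := by
    have : expSU ((T - T) • C) = 1 := by
      apply Subtype.ext
      rw [coe_expSU, sub_self, zero_smul]
      exact exp_zero
    rw [this, one_mul]
  -- Making `T` a breakpoint leaves no condition on the equation at the junction, where the two
  -- state branches agree.
  refine ⟨T + t, by positivity, fun s ↦ if s < T then u s else c, insert T D,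
    fun s ↦ if s ≤ T then X s else expSU ((s - T) • C) * X T, ?_, ⟨?_, ?_, ?_⟩, ?_⟩
  · intro s r hsr hD
    have hT' := hD T (Finset.mem_insert_self _ _)
    simp only [Set.mem_Icc, not_and_or, not_le] at hT'
    rcases hT' with h | h
    · simp [h.le.not_gt, (h.le.trans hsr).not_gt]
    · simp only [h, hsr.trans_lt h, if_true]
      exact hu s r hsr fun d hd ↦ hD d (Finset.mem_insert_of_mem hd)
  · simp [hT, hX0]
  · refine ContinuousOn.if ?_ ?_ ?_
    · rintro s ⟨-, hs⟩
      have : s = T := by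
        have := frontier_le_subset_eq continuous_id continuous_const hs
        simpa using this
      rw [this, hflowT]
    · refine hXc.mono ?_
      rintro s ⟨hs, hsT⟩
      have hcl : closure {a : ℝ | a ≤ T} = {a | a ≤ T} := isClosed_Iic.closure_eq
      rw [hcl] at hsT
      exact ⟨hs.1, hsT⟩
    · exact hflow.continuousOn
  · intro s hs hsD i j
    have hsT : s ≠ T := fun h ↦ hsD (h ▸ Finset.mem_insert_self _ _)
    rcases lt_or_gt_of_ne hsT with h | h
    · simp only [h, h.le, if_true]
      refine (hXd s ⟨hs.1, h⟩ (fun hd ↦ hsD (Finset.mem_insert_of_mem hd)) i j).congr_of_eventuallyEq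
        ?_
      filter_upwards [gt_mem_nhds h] with r hr
      simp [hr.le]
    · simp only [h.not_ge, h.le.not_gt, if_false]
      have hd : HasDerivAt (fun r : ℝ ↦ exp ((r - T) • (A + c • B)) *
          (X T : Matrix (Fin N) (Fin N) ℂ)) ((A + c • B) * (exp ((s - T) • (A + c • B)) *
          (X T : Matrix (Fin N) (Fin N) ℂ))) s := by
        have h1 := (hasDerivAt_exp_smul_const' (𝕂 := ℝ) (A + c • B) (s - T)).comp_sub_const s T
        rw [← mul_assoc]
        exact h1.mul_const _
      refine (hasDerivAt_matrix_apply hd i j).congr_of_eventuallyEq ?_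
      filter_upwards [lt_mem_nhds h] with r hr
      simp only [hr.not_ge, if_false]
      rfl
  · rcases ht.eq_or_lt with rfl | ht'
    · have : g = 1 := Subtype.ext (by rw [hg, zero_smul]; exact exp_zero)
      simp [this]
    · simp only [add_le_iff_nonpos_right, ht'.not_ge, if_false, add_sub_cancel_left]
      congr 1
      exact Subtype.ext hg.symm

/-- Later inputs multiply on the left, so the induction peels generators off the left. -/
theorem flowMonoid_subset_reachableSet {A B : Matrix (Fin N) (Fin N) ℂ} (hA : A ∈ su N)
    (hB : B ∈ su N) :
    (flowMonoid (Set.range fun c : ℝ ↦ A + c • B) : Set (specialUnitaryGroup (Fin N) ℂ)) ⊆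
      reachableSet A B := by
  intro g hg
  induction hg using Submonoid.closure_induction_left with
  | one => exact one_mem_reachableSet A B
  | mul_left g hg y _ hy =>
    obtain ⟨_, ⟨c, rfl⟩, t, ht, hg⟩ := hg
    exact exp_mul_mem_reachableSet hA hB hy c ht hg

end QuantumControl

theorem mainTheorem1 (N : ℕ) (A B : Matrix (Fin N) (Fin N) ℂ)
    (hA : A ∈ QuantumControl.su N) (hB : B ∈ QuantumControl.su N)
    (hdiag : A.IsDiag) (hord : Monotone (QuantumControl.energy A))
    (hconn : (QuantumControl.matrixGraph B).toSimpleGraphInclusive.Connected)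
    (hreg : QuantumControl.IsRegularAlong A B) :
    QuantumControl.IsControllable A B := by
  open QuantumControl in
  set 𝒞 : Set (Matrix (Fin N) (Fin N) ℂ) := Set.range fun c : ℝ ↦ A + c • B
  have h𝒞 : 𝒞 ⊆ su N := by
    rintro _ ⟨c, rfl⟩
    exact (su N).add_mem hA ((su N).smul_mem c hB)
  have hAW : A ∈ orbitSpan 𝒞 := subset_orbitSpan 𝒞 ⟨0, by simp⟩
  have hBW : B ∈ orbitSpan 𝒞 := by
    have h := (orbitSpan 𝒞).sub_mem (subset_orbitSpan 𝒞 ⟨1, rfl⟩) hAW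
    simpa using h
  have hsu : su N ≤ orbitSpan 𝒞 := su_le_of_mem hA hB hdiag hord hconn hreg _
    (fun _ hx _ hy ↦ bracket_mem_orbitSpan h𝒞 hx hy) hAW hBW
  obtain ⟨L, hL, hWL⟩ := exists_isVelocitySpace_orbitSpan_le h𝒞
  obtain ⟨y, hy⟩ := hL.exists_mem_nhds (hsu.trans hWL)
  have : NeZero N := Fin.pos_iff_nonempty.2 hconn.nonempty |>.ne' |> NeZero.mk
  refine Set.eq_univ_of_forall fun g ↦ flowMonoid_subset_reachableSet hA hB ?_
  rw [SetLike.mem_coe, flowMonoid_eq_top hy]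
  trivial
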